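/- Assume the continuum hypothesis $2^{\aleph_0}=\aleph_1$. Let $R$ be a subring of $\mathbb{Q}$ and let $G$ be an $R$-module of type I. Then $G$ is not a splitter, i.e. $\operatorname{Ext}^1_R(G,G)\neq 0$. Here an $R$-module $M$ is called *minimal non-free* if it is torsion-free of finite rank and not free, but all its pure submodules of smaller rank are free (a submodule $N\subseteq M$ is *pure* if $N\cap rM=rN$ for all $r\in R$). The $R$-module $G$ is *of type I* if it is the union $G=\bigcup_{\alpha<\omega_1}G_\alpha$ of an ascending chain of countable, free, pure submodules $G_\alpha$ which is continuous ($G_\lambda=\bigcup_{\beta<\lambda}G_\beta$ for every limit ordinal $\lambda<\omega_1$), such that $G_{\alpha+1}/G_\alpha$ is minimal non-free for every $\alpha$ with $0<\alpha<\omega_1$. -/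

import Mathlib

universe u v

open scoped Cardinal Ordinal

/-- An `R`-module `G` is a *splitter* if `Ext¹_R(G, G) = 0`. -/
def IsSplitter (R : Type) [CommRing R] (G : Type v) [AddCommGroup G] [Module R G] : Prop :=
  Subsingleton
    (CategoryTheory.Abelian.Ext.{v} (ModuleCat.of.{v} R G) (ModuleCat.of.{v} R G) 1)

/-- A submodule `N` of `M` is *pure* if `N ∩ rM = rN` for all scalars `r`: every element of `N`
which is divisible by `r` in `M` is divisible by `r` in `N`. (All rings considered are principal
ideal domains, where this is the usual notion of purity.) -/
def IsPureSubmodule {R : Type u} [CommRing R] {M : Type v} [AddCommGroup M] [Module R M]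
    (N : Submodule R M) : Prop :=
  ∀ (r : R) (x : M), r • x ∈ N → ∃ y ∈ N, r • y = r • x

/-- A *minimal non-free* module: a torsion-free module of finite rank which is not free, but all
of whose pure submodules of smaller rank are free. The rank `Module.rank R M` is the largest size
of a linearly independent family, i.e. the usual torsion-free rank when `R` is a domain. -/
structure IsMinimalNonFree (R : Type u) [CommRing R] (M : Type v) [AddCommGroup M]
    [Module R M] : Prop where
  torsionFree : Module.IsTorsionFree R M
  finite_rank : Module.rank R M < ℵ₀
  not_free : ¬ Module.Free R M
  free_of_pure : ∀ N : Submodule R M, IsPureSubmodule N →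
    Module.rank R N < Module.rank R M → Module.Free R N

/-- `F` is an *`ℵ₁`-filtration* of `G`: the `F α` for `α < ω₁` form an ascending, continuous chain
of countable, free, pure submodules with union `G`. (Only the values at `α < ω₁` matter. The first
member `F 0` need not be zero.) -/
structure IsAlephOneFiltration {R : Type u} [CommRing R] {G : Type v} [AddCommGroup G]
    [Module R G] (F : Ordinal.{0} → Submodule R G) : Prop where
  mono : ∀ ⦃α β : Ordinal.{0}⦄, α ≤ β → β < ω₁ → F α ≤ F β
  continuous : ∀ α < ω₁, Order.IsSuccLimit α → ∀ x ∈ F α, ∃ β < α, x ∈ F β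
  union : ∀ x : G, ∃ α < ω₁, x ∈ F α
  countable : ∀ α < ω₁, Countable (F α)
  free : ∀ α < ω₁, Module.Free R (F α)
  pure : ∀ α < ω₁, IsPureSubmodule (F α)

/-- `G` is *of type I* if it has an `ℵ₁`-filtration `(G_α)` such that each quotient
`G_{α+1} / G_α` with `0 < α < ω₁` is minimal non-free. -/
def IsTypeI (R : Type u) [CommRing R] (G : Type v) [AddCommGroup G] [Module R G] : Prop :=
  ∃ F : Ordinal.{0} → Submodule R G, IsAlephOneFiltration F ∧
    ∀ α : Ordinal.{0}, 0 < α → α < ω₁ →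
      IsMinimalNonFree R (↥(F (Order.succ α)) ⧸ (F α).submoduleOf (F (Order.succ α)))

/-! Let `I` be the localization of `G` at the nonzero scalars, a divisible and hence injective
module, and let `D = I / G`. If `Ext¹(G, G) = 0`, every homomorphism `G → D` lifts to `I`.

Each quotient `C = G_{α+1} / G_α` is torsion-free of finite rank but not finitely generated. It has
uncountably many homomorphisms to `ℚ / R` but only countably many to `ℚ`, so some homomorphism does
not lift. Since an element of `G` splits off together with any countable set, `ℚ / R` can be mapped
to `D` so that this one has no lift to `I` either (`exists_hom_not_lift`).

At each stage a homomorphism to `D` can thus be extended in two ways, differing by a map without a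
lift, so a lift on `G_α` is compatible with at most one of them. Any `ω₁`-sequence of bits can
therefore be built into a homomorphism `G → D` and recovered from its lift, the bit at `α` from the
restriction to `G_α` alone (`exists_bit_functions`). Under the continuum hypothesis a weak diamond
argument forbids this (`exists_bits_ne_of_continuum_eq_aleph_one`). -/

/-! ### Extending homomorphisms into injective modules -/

section Injective

variable {R : Type*} [CommRing R] {D : Type*} [AddCommGroup D] [Module R D]

/-- Over a principal ideal domain, divisible modules satisfy Baer's criterion. -/
theorem Module.Baer.of_smul_surjective [IsDomain R] [IsPrincipalIdealRing R]
    (h : ∀ r : R, r ≠ 0 → ∀ y : D, ∃ z : D, r • z = y) : Module.Baer R D := by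
  intro I g
  obtain ⟨a, rfl⟩ := (IsPrincipalIdealRing.principal I).principal
  by_cases ha : a = 0
  · refine ⟨0, fun x hx => ?_⟩
    have hx0 : x = 0 := by simpa [ha] using hx
    subst hx0
    have : (⟨0, hx⟩ : R ∙ a) = 0 := rfl
    simp [this]
  · obtain ⟨z, hz⟩ := h a ha (g ⟨a, Submodule.mem_span_singleton_self a⟩)
    refine ⟨LinearMap.toSpanSingleton R D z, fun x hx => ?_⟩
    obtain ⟨s, rfl⟩ := Submodule.mem_span_singleton.1 hx
    have : (⟨s • a, hx⟩ : R ∙ a) = s • ⟨a, Submodule.mem_span_singleton_self a⟩ := rfl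
    rw [this, map_smul, map_smul, LinearMap.toSpanSingleton_apply, hz]

variable {G : Type*} [AddCommGroup G] [Module R G]

/-- Homomorphisms on submodules extend to homomorphisms into an injective module. -/
theorem Module.Baer.exists_extend (hD : Module.Baer R D) (N : Submodule R G) (g : N →ₗ[R] D) :
    ∃ φ : G →ₗ[R] D, ∀ x : N, φ x = g x := by
  obtain ⟨φ, hφ⟩ := hD.extension_property N.subtype N.injective_subtype g
  exact ⟨φ, fun x => LinearMap.congr_fun hφ x⟩

/-- Compatible homomorphisms on a chain of submodules have a common extension to a homomorphism
into an injective module. -/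
theorem Module.Baer.exists_extend_chain (hD : Module.Baer R D) {ι : Type*} [LinearOrder ι]
    (N : ι → Submodule R G) (hN : Monotone N) (ψ : ι → G →ₗ[R] D)
    (hψ : ∀ i j, i ≤ j → ∀ x ∈ N i, ψ j x = ψ i x) :
    ∃ φ : G →ₗ[R] D, ∀ i, ∀ x ∈ N i, φ x = ψ i x := by
  rcases isEmpty_or_nonempty ι with _ | _
  · exact ⟨0, fun i => isEmptyElim i⟩
  have hmem : ∀ x : ↥(⨆ i, N i), ∃ i, (x : G) ∈ N i := fun x =>
    (Submodule.mem_iSup_of_directed N hN.directed_le).1 x.2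
  choose k hk using hmem
  have key : ∀ (x : ↥(⨆ i, N i)) (j : ι), (x : G) ∈ N j → ψ (k x) x = ψ j x := by
    intro x j hj
    rcases le_total (k x) j with h | h
    · exact (hψ _ _ h _ (hk x)).symm
    · exact hψ _ _ h _ hj
  let g : ↥(⨆ i, N i) →ₗ[R] D :=
    { toFun := fun x => ψ (k x) x
      map_add' := fun x y => by
        have hx := hN (le_max_left (k x) (k y)) (hk x)
        have hy := hN (le_max_right (k x) (k y)) (hk y)
        rw [key x _ hx, key y _ hy, key (x + y) _ (add_mem hx hy), Submodule.coe_add, map_add]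
      map_smul' := fun r x => by
        rw [key (r • x) _ (Submodule.smul_mem _ r (hk x)), Submodule.coe_smul, map_smul,
          RingHom.id_apply] }
  obtain ⟨φ, hφ⟩ := hD.exists_extend _ g
  refine ⟨φ, fun i x hx => ?_⟩
  have hx' : x ∈ ⨆ i, N i := Submodule.mem_iSup_of_mem i hx
  rw [← key ⟨x, hx'⟩ i hx]
  exact hφ ⟨x, hx'⟩

/-- Transfinite recursion for homomorphisms into an injective module: if each `T i` modifies a
homomorphism outside `N i` in a way that depends only on its restriction to `N i`, then there is
a homomorphism which every `T i` fixes on the larger submodule `N' i`. -/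
theorem Module.Baer.exists_fixed_of_steps (hD : Module.Baer R D) {ι : Type*} [LinearOrder ι]
    [WellFoundedLT ι] (N N' : ι → Submodule R G) (hNN' : ∀ i, N i ≤ N' i)
    (hN'N : ∀ i j, i < j → N' i ≤ N j) (T : ι → (G →ₗ[R] D) → (G →ₗ[R] D))
    (hT : ∀ i ψ, ∀ x ∈ N i, T i ψ x = ψ x)
    (hTT : ∀ i ψ ψ', (∀ x ∈ N i, ψ x = ψ' x) → ∀ x ∈ N' i, T i ψ x = T i ψ' x) :
    ∃ φ : G →ₗ[R] D, ∀ i, ∀ x ∈ N' i, φ x = T i φ x := by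
  classical
  have hmono : Monotone N' := fun i j hij => by
    rcases hij.eq_or_lt with rfl | h
    · exact le_rfl
    · exact (hN'N i j h).trans (hNN' j)
  have wf : WellFounded ((· < ·) : ι → ι → Prop) := wellFounded_lt
  -- `Φ j` is a common extension of all earlier steps; that one exists is shown by induction in
  -- `main`.
  let Φ : ι → (G →ₗ[R] D) := wf.fix fun j rec =>
    Classical.epsilon fun φ : G →ₗ[R] D => ∀ i (h : i < j), ∀ x ∈ N' i, φ x = T i (rec i h) x
  have hΦ : ∀ j, Φ j = Classical.epsilon fun φ : G →ₗ[R] D =>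
      ∀ i, i < j → ∀ x ∈ N' i, φ x = T i (Φ i) x := fun j => wf.fix_eq _ j
  have glue : ∀ s : Set ι, (∀ j ∈ s, ∀ i < j, ∀ x ∈ N' i, Φ j x = T i (Φ i) x) →
      ∃ φ : G →ₗ[R] D, ∀ i ∈ s, ∀ x ∈ N' i, φ x = T i (Φ i) x := by
    intro s hs
    obtain ⟨φ, hφ⟩ := hD.exists_extend_chain (ι := s) (fun i => N' i)
      (fun i j h => hmono h) (fun i => T i (Φ i)) (by
        rintro ⟨i, hi⟩ ⟨j, hj⟩ hij x hx
        rcases (show i ≤ j from hij).eq_or_lt with rfl | h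
        · rfl
        · exact (hT j _ x (hN'N i j h hx)).trans (hs j hj i h x hx))
    exact ⟨φ, fun i hi => hφ ⟨i, hi⟩⟩
  have main : ∀ j, ∀ i < j, ∀ x ∈ N' i, Φ j x = T i (Φ i) x := by
    intro j
    induction j using wf.induction with
    | _ j ih =>
      rw [hΦ j]
      exact Classical.epsilon_spec (glue (Set.Iio j) fun k hk => ih k hk)
  obtain ⟨φ, hφ⟩ := glue Set.univ fun j _ => main j
  refine ⟨φ, fun i x hx => (hφ i trivial x hx).trans (hTT i _ _ (fun y hy => ?_) x hx)⟩
  rw [hφ i trivial y (hNN' i hy), hT i _ y hy]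

end Injective

/-! ### Homomorphisms into `K / R` -/

section FractionField

variable (R : Type*) [CommRing R] (K : Type*) [Field K] [Algebra R K]

/-- The quotient module `K / R` of a field by a subring. -/
abbrev FieldModRing : Type _ := K ⧸ LinearMap.range (Algebra.linearMap R K)

variable [IsDomain R] [IsPrincipalIdealRing R] [IsFractionRing R K]

theorem baer_fractionRing : Module.Baer R K :=
  .of_smul_surjective fun r hr y => ⟨y / algebraMap R K r, by
    have : algebraMap R K r ≠ 0 := by simpa using hr
    rw [Algebra.smul_def, mul_div_cancel₀ _ this]⟩

theorem Module.Baer.quotient {R : Type*} [CommRing R] [IsDomain R] [IsPrincipalIdealRing R]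
    {M : Type*} [AddCommGroup M] [Module R M] (N : Submodule R M)
    (h : ∀ r : R, r ≠ 0 → ∀ y : M, ∃ z : M, r • z = y) : Module.Baer R (M ⧸ N) := by
  refine .of_smul_surjective fun r hr y => ?_
  obtain ⟨y, rfl⟩ := N.mkQ_surjective y
  obtain ⟨z, rfl⟩ := h r hr y
  exact ⟨N.mkQ z, (map_smul _ _ _).symm⟩

theorem baer_fieldModRing : Module.Baer R (FieldModRing R K) :=
  .quotient _ fun r hr y => ⟨y / algebraMap R K r, by
    have : algebraMap R K r ≠ 0 := by simpa using hr
    rw [Algebra.smul_def, mul_div_cancel₀ _ this]⟩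

/-- `K / R` cogenerates the torsion modules. -/
theorem exists_fieldModRing_apply_ne_zero {T : Type*} [AddCommGroup T] [Module R T] (t : T)
    (ht : t ≠ 0) (r : R) (hr : r ≠ 0) (hrt : r • t = 0) :
    ∃ χ : T →ₗ[R] FieldModRing R K, χ t ≠ 0 := by
  obtain ⟨a, ha⟩ := (IsPrincipalIdealRing.principal (Ideal.torsionOf R T t)).principal
  have hmem : ∀ s : R, s • t = 0 ↔ a ∣ s := fun s => by
    rw [← Ideal.mem_torsionOf_iff, ha]
    exact Ideal.mem_span_singleton
  have ha0 : a ≠ 0 := by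
    rintro rfl
    exact hr (zero_dvd_iff.1 ((hmem r).1 hrt))
  have haK : algebraMap R K a ≠ 0 := by simpa using ha0
  -- Since `a` generates the annihilator of `t`, sending `t` to the class of `1 / a` is well
  -- defined; this class vanishes only if `a` is a unit, that is, if `t = 0`.
  let q := (LinearMap.range (Algebra.linearMap R K)).mkQ
  let g : R →ₗ[R] FieldModRing R K := LinearMap.toSpanSingleton R _ (q (algebraMap R K a)⁻¹)
  have hg : ∀ s, g s = q (algebraMap R K s / algebraMap R K a) := fun s => by
    simp only [g, LinearMap.toSpanSingleton_apply, ← map_smul, Algebra.smul_def, div_eq_mul_inv]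
  have hker : Ideal.torsionOf R T t ≤ LinearMap.ker g := by
    intro s hs
    obtain ⟨c, rfl⟩ := (hmem s).1 hs
    rw [LinearMap.mem_ker, hg, map_mul, mul_div_cancel_left₀ _ haK]
    exact (Submodule.Quotient.mk_eq_zero _).2 ⟨c, rfl⟩
  let h : (R ∙ t) →ₗ[R] FieldModRing R K :=
    (Submodule.liftQ _ g hker) ∘ₗ (Ideal.quotTorsionOfEquivSpanSingleton R T t).symm.toLinearMap
  obtain ⟨χ, hχ⟩ := (baer_fieldModRing R K).exists_extend _ h
  refine ⟨χ, ?_⟩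
  have h1 := hχ ⟨t, Submodule.mem_span_singleton_self t⟩
  have h2 : (Ideal.quotTorsionOfEquivSpanSingleton R T t).symm
      ⟨t, Submodule.mem_span_singleton_self t⟩ = Submodule.Quotient.mk 1 := by
    rw [LinearEquiv.symm_apply_eq]
    exact Subtype.ext (one_smul R t).symm
  have h3 : χ t = g 1 := by
    rw [h1]
    simp only [h, LinearMap.comp_apply, LinearEquiv.coe_coe, h2, Submodule.liftQ_apply]
  rw [h3, hg, map_one]
  intro h0
  obtain ⟨c, hc⟩ := (Submodule.Quotient.mk_eq_zero _).1 h0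
  have hac : a ∣ 1 := by
    refine ⟨c, IsFractionRing.injective R K ?_⟩
    rw [map_one, map_mul, ← Algebra.linearMap_apply R K c, hc, mul_div_cancel₀ _ haK]
  exact ht (by simpa using (hmem 1).2 hac)

/-- A torsion module which is not finitely generated has uncountably many homomorphisms
into `K / R`. -/
theorem exists_hom_fieldModRing_ne {T : Type*} [AddCommGroup T] [Module R T]
    (hT : ∀ t : T, ∃ r : R, r ≠ 0 ∧ r • t = 0) (hfin : ¬ Module.Finite R T)
    (f : ℕ → (T →ₗ[R] FieldModRing R K)) :
    ∃ φ : T →ₗ[R] FieldModRing R K, ∀ k, φ ≠ f k := by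
  classical
  have hex : ∀ s : Finset T, ∃ t : T, t ∉ Submodule.span R (s : Set T) := by
    intro s
    by_contra! h
    exact hfin ⟨⟨s, eq_top_iff.2 fun t _ => h t⟩⟩
  choose t ht using hex
  obtain ⟨s, hs⟩ : ∃ s : ℕ → Finset T, ∀ n, s (n + 1) = insert (t (s n)) (s n) :=
    ⟨fun n => n.rec ∅ fun _ s => insert (t s) s, fun _ => rfl⟩
  have hsmono : Monotone s := monotone_nat_of_le_succ fun n => by
    rw [hs]; exact Finset.subset_insert _ _
  let N : ℕ → Submodule R T := fun n => Submodule.span R ((s n : Finset T) : Set T)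
  have hN : Monotone N := fun i j h => Submodule.span_mono (Finset.coe_subset.2 (hsmono h))
  have htN : ∀ n, t (s n) ∈ N (n + 1) := fun n => Submodule.subset_span (by simp [hs])
  have hχ : ∀ n, ∃ χ : T →ₗ[R] FieldModRing R K, (∀ x ∈ N n, χ x = 0) ∧ χ (t (s n)) ≠ 0 := by
    intro n
    obtain ⟨r, hr, hrt⟩ := hT (t (s n))
    obtain ⟨χ, hχ⟩ := exists_fieldModRing_apply_ne_zero R K ((N n).mkQ (t (s n)))
      (fun h => ht _ ((Submodule.Quotient.mk_eq_zero _).1 h)) r hr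
      (by rw [← map_smul, hrt, map_zero])
    refine ⟨χ ∘ₗ (N n).mkQ, fun x hx => ?_, hχ⟩
    simp [(Submodule.Quotient.mk_eq_zero (N n)).2 hx]
  choose χ hχ0 hχ1 using hχ
  have hB := baer_fieldModRing R K
  have hE : ∀ n (ψ : N n →ₗ[R] FieldModRing R K), ∃ φ : T →ₗ[R] FieldModRing R K,
    ∀ x : N n, φ x = ψ x := fun n ψ => hB.exists_extend (N n) ψ
  choose E hE using hE
  -- Diagonalization: `χ n` is added exactly when the extension would agree with `f n` at the new
  -- element `t (s n)`.
  let T' : ℕ → (T →ₗ[R] FieldModRing R K) → (T →ₗ[R] FieldModRing R K) := fun n ψ =>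
    if E n (ψ.domRestrict (N n)) (t (s n)) = f n (t (s n)) then E n (ψ.domRestrict (N n)) + χ n
    else E n (ψ.domRestrict (N n))
  have hne : ∀ n ψ, T' n ψ (t (s n)) ≠ f n (t (s n)) := by
    intro n ψ
    by_cases h : E n (ψ.domRestrict (N n)) (t (s n)) = f n (t (s n))
    · simp only [T', if_pos h, LinearMap.add_apply, h]
      simpa using hχ1 n
    · simpa only [T', if_neg h] using h
  obtain ⟨φ, hφ⟩ := hB.exists_fixed_of_steps N (fun n => N (n + 1)) (fun n => hN n.le_succ)
    (fun i j h => hN h) T' (fun n ψ x hx => by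
      have := hE n (ψ.domRestrict (N n)) ⟨x, hx⟩
      simp only [LinearMap.domRestrict_apply] at this
      by_cases h : E n (ψ.domRestrict (N n)) (t (s n)) = f n (t (s n))
      · simp only [T', if_pos h, LinearMap.add_apply, hχ0 n x hx, add_zero, this]
      · simp only [T', if_neg h, this])
    (fun n ψ ψ' h x _ => by
      have : ψ.domRestrict (N n) = ψ'.domRestrict (N n) := by
        ext y
        exact h y y.2
      simp only [T', this])
  refine ⟨φ, fun k hk => hne k φ ?_⟩
  rw [← hφ k _ (htN k), hk]

/-- A module of finite torsion-free rank over a countable principal ideal domain which is not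
finitely generated admits a homomorphism into `K / R` which does not lift to `K`. -/
theorem exists_hom_fieldModRing_not_lift [Countable K] {C : Type*} [AddCommGroup C] [Module R C]
    (s : Set C) (hs : s.Finite)
    (hC : ∀ c : C, ∃ r : R, r ≠ 0 ∧ r • c ∈ Submodule.span R s) (hfin : ¬ Module.Finite R C) :
    ∃ χ : C →ₗ[R] FieldModRing R K, ∀ f : C →ₗ[R] K,
      (LinearMap.range (Algebra.linearMap R K)).mkQ ∘ₗ f ≠ χ := by
  by_contra! hlift
  let A := Submodule.span R s
  let q := (LinearMap.range (Algebra.linearMap R K)).mkQ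
  have hT : ∀ t : C ⧸ A, ∃ r : R, r ≠ 0 ∧ r • t = 0 := by
    intro t
    obtain ⟨c, rfl⟩ := A.mkQ_surjective t
    obtain ⟨r, hr, hrc⟩ := hC c
    refine ⟨r, hr, ?_⟩
    rw [← map_smul]
    exact (Submodule.Quotient.mk_eq_zero _).2 hrc
  have hTfin : ¬ Module.Finite R (C ⧸ A) := by
    intro h
    have : Module.Finite R A := Module.Finite.iff_fg.2 (Submodule.fg_span hs)
    exact hfin (Module.Finite.of_submodule_quotient A)
  have : Finite s := hs
  choose l hl using fun ψ : (C ⧸ A) →ₗ[R] FieldModRing R K => hlift (ψ ∘ₗ A.mkQ)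
  -- A lift to `K` is determined by its values on the finite set `s`, because `C / A` is torsion and
  -- `K` is torsion-free; there are only countably many such value tables.
  have hinj : Function.Injective
      fun (ψ : (C ⧸ A) →ₗ[R] FieldModRing R K) (a : s) => l ψ a := by
    intro ψ ψ' h
    have hA : ∀ x ∈ A, l ψ x = l ψ' x := by
      intro x hx
      exact LinearMap.eqOn_span (fun y hy => congr_fun h ⟨y, hy⟩) hx
    have hll : l ψ = l ψ' := by
      ext c
      obtain ⟨r, hr, hrc⟩ := hC c
      have h1 := hA _ hrc
      rw [map_smul, map_smul, Algebra.smul_def, Algebra.smul_def] at h1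
      exact mul_left_cancel₀ (by simpa using hr) h1
    have h2 : ψ ∘ₗ A.mkQ = ψ' ∘ₗ A.mkQ := by rw [← hl ψ, ← hl ψ', hll]
    exact (LinearMap.cancel_right A.mkQ_surjective).1 h2
  have hcount : Countable ((C ⧸ A) →ₗ[R] FieldModRing R K) := hinj.countable
  obtain ⟨f, hf⟩ := exists_surjective_nat ((C ⧸ A) →ₗ[R] FieldModRing R K)
  obtain ⟨φ, hφ⟩ := exists_hom_fieldModRing_ne R K hT hTfin f
  obtain ⟨k, hk⟩ := hf φ
  exact hφ k hk.symm

end FractionField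

/-! ### A weak diamond from the continuum hypothesis -/

section Counting

/-- Countable powers of sets of size at most continuum have size at most continuum. -/
theorem nonempty_countable_pi_embedding {S Y : Type*} [Countable S]
    (h : Nonempty (Y ↪ (ℕ → Bool))) : Nonempty ((S → Y) ↪ (ℕ → Bool)) := by
  obtain ⟨i⟩ := h
  obtain ⟨e, he⟩ := exists_injective_nat (S × ℕ)
  refine ⟨⟨fun f => Function.extend e (fun p => i (f p.1) p.2) fun _ => false, fun f g hfg => ?_⟩⟩
  have := Function.extend_injective he (fun _ => false) hfg
  funext s
  apply i.injective
  funext n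
  exact congr_fun this (s, n)

/-- Under the continuum hypothesis, `ω₁`-sequences of bits are not embeddable in the reals. -/
theorem isEmpty_embedding_of_continuum_eq_aleph_one (hCH : (𝔠 : Cardinal.{0}) = ℵ₁) :
    IsEmpty ((Set.Iio (ω₁ : Ordinal.{0}) → Bool) ↪ (ℕ → Bool)) := by
  refine ⟨fun i => ?_⟩
  have h := Cardinal.lift_mk_le'.2 ⟨i⟩
  have h1 : Cardinal.mk (Set.Iio (ω₁ : Ordinal.{0})) = Cardinal.lift.{1, 0} 𝔠 := by
    rw [Cardinal.mk_Iio_ordinal, Ordinal.card_omega, hCH]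
  have h2 : Cardinal.mk (ℕ → Bool) = 𝔠 := by simp
  have h3 : Cardinal.mk (Set.Iio (ω₁ : Ordinal.{0}) → Bool) = 2 ^ Cardinal.lift.{1, 0} 𝔠 := by
    rw [← h1]; simp
  rw [h2, h3] at h
  rw [Cardinal.lift_id'.{0, 1}] at h
  exact absurd h (not_le.2 (Cardinal.cantor _))

/-- A weak diamond principle: if `p α f` depends only on the restriction of `f` to the
countable set `A α`, then some sequence of bits is not of the form `α ↦ p α f`. -/
theorem exists_bits_ne_of_continuum_eq_aleph_one (hCH : (𝔠 : Cardinal.{0}) = ℵ₁) {X Y : Type*}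
    (hY : Nonempty (Y ↪ (ℕ → Bool))) (A : Ordinal.{0} → Set X)
    (hcount : ∀ α < ω₁, (A α).Countable) (hmono : ∀ α β, α ≤ β → β < ω₁ → A α ⊆ A β)
    (hlim : ∀ α < ω₁, Order.IsSuccLimit α → ∀ x ∈ A α, ∃ β < α, x ∈ A β)
    (p : Ordinal.{0} → (X → Y) → Bool)
    (hp : ∀ α f g, Set.EqOn f g (A α) → p α f = p α g) :
    ∃ ε : Ordinal.{0} → Bool, ∀ f : X → Y, ∃ α, 0 < α ∧ α < ω₁ ∧ p α f ≠ ε α := by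
  by_contra! hF
  choose F hF using hF
  have hc : ∀ α, ∃ c : (ℕ → A α → Y) → (ℕ → Bool), α < ω₁ → Function.Injective c := by
    intro α
    by_cases hα : α < ω₁
    · have := (hcount α hα).to_subtype
      obtain ⟨c⟩ := nonempty_countable_pi_embedding (S := ℕ)
        (nonempty_countable_pi_embedding (S := A α) hY)
      exact ⟨c, fun _ => c.injective⟩
    · exact ⟨fun _ _ => false, fun h => absurd h hα⟩
  choose c hc using hc
  -- Level `n + 1` encodes at `α` the restrictions to `A (α + 1)` of all functions of level `n`. Its
  -- bits are read off at `A α`, so level `n + 1` on `A α` determines level `n` on `A (α + 1)`.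
  let e : (Ordinal.{0} → Bool) → ℕ → Ordinal.{0} → ℕ → Bool := fun b n =>
    n.rec (fun α _ => b α)
      fun _ en α => c (Order.succ α) fun m x => F (fun β => en β m) x
  let f : (Ordinal.{0} → Bool) → ℕ → ℕ → X → Y := fun b n m => F fun β => e b n β m
  have he : ∀ b n α, e b (n + 1) α = c (Order.succ α) fun m x => f b n m x := fun _ _ _ => rfl
  have hpf : ∀ b n m α, 0 < α → α < ω₁ → e b n α m = p α (f b n m) :=
    fun b n m α h0 h1 => (hF (fun β => e b n β m) α h0 h1).symm
  have hω : Order.IsSuccLimit (ω₁ : Ordinal.{0}) := Cardinal.isSuccLimit_omega 1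
  -- All levels are carried along together, since each successor step uses up one. The base is `A 1`
  -- because the bit at `0` is not controlled.
  have main : ∀ b b', (∀ n m, Set.EqOn (f b n m) (f b' n m) (A 1)) →
      ∀ α, 0 < α → α < ω₁ → ∀ n m, Set.EqOn (f b n m) (f b' n m) (A α) := by
    intro b b' h α
    induction α using Ordinal.limitRecOn with
    | zero => exact fun h0 => absurd h0 (lt_irrefl _)
    | add_one α ih =>
      rw [← Order.succ_eq_add_one]
      intro _ hα1 n m
      have hα : α < ω₁ := (Order.lt_succ α).trans hα1
      rcases eq_or_ne α 0 with rfl | hα0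
      · simpa using h n m
      have hpos : 0 < α := pos_iff_ne_zero.2 hα0
      have h1 : e b (n + 1) α = e b' (n + 1) α := by
        funext k
        exact (hpf b (n + 1) k α hpos hα).trans ((hp α _ _ (ih hpos hα (n + 1) k)).trans
          (hpf b' (n + 1) k α hpos hα).symm)
      rw [he b, he b'] at h1
      intro x hx
      exact congr_fun (congr_fun (hc _ hα1 h1) m) ⟨x, hx⟩
    | limit α hlimα ih =>
      intro h0 hα n m x hx
      obtain ⟨β, hβ, hxβ⟩ := hlim α hα hlimα x hx
      have h1 : (1 : Ordinal) < α := by simpa using hlimα.succ_lt h0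
      have hmax : max β 1 < α := max_lt hβ h1
      exact ih (max β 1) hmax (lt_of_lt_of_le zero_lt_one (le_max_right _ _)) (hmax.trans hα) n m
        (hmono _ _ (le_max_left _ _) (hmax.trans hα) hxβ)
  have h1 : (1 : Ordinal.{0}) < ω₁ := by simpa using hω.succ_lt (Ordinal.omega_pos 1)
  have := (hcount 1 h1).to_subtype
  obtain ⟨i⟩ := nonempty_countable_pi_embedding (S := ℕ) (nonempty_countable_pi_embedding (S := ℕ)
    (nonempty_countable_pi_embedding (S := A 1) hY))
  have hsucc : Function.Injective fun a : Set.Iio (ω₁ : Ordinal.{0}) => Order.succ a.1 :=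
    fun a a' h => Subtype.ext (Order.succ_injective h)
  -- The bits are placed at successors to avoid the index `0`.
  let b : (Set.Iio (ω₁ : Ordinal.{0}) → Bool) → Ordinal.{0} → Bool := fun d =>
    Function.extend (fun a : Set.Iio (ω₁ : Ordinal.{0}) => Order.succ a.1) d fun _ => false
  refine (isEmpty_embedding_of_continuum_eq_aleph_one hCH).false
    ⟨fun d => i fun n m x => f (b d) n m x, fun d d' h => ?_⟩
  have h2 := main (b d) (b d') fun n m x hx =>
    congr_fun (congr_fun (congr_fun (i.injective h) n) m) ⟨x, hx⟩
  funext a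
  have ha : Order.succ a.1 < ω₁ := hω.succ_lt a.2
  have hpos : 0 < Order.succ a.1 := Order.lt_succ_of_le (zero_le (a := a.1))
  have h3 : b d (Order.succ a.1) = b d' (Order.succ a.1) := by
    exact (hpf (b d) 0 0 _ hpos ha).trans ((hp _ _ _ (h2 _ hpos ha 0 0)).trans
      (hpf (b d') 0 0 _ hpos ha).symm)
  simpa only [b, hsucc.extend_apply] using h3

end Counting

/-! ### Coding bits into homomorphisms -/

section Bits

/-- If the homomorphisms `χ α` into an injective module `D` vanish on `F α` and have no lift
along `q : I → D` on `F (α + 1)` which vanishes on `F α`, whereas all homomorphisms on `G` lift,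
then every sequence of bits can be read off from some homomorphism `G → I`, the bit with index `α`
from the restriction to `F α`. -/
theorem exists_bit_functions {R G I D : Type*} [CommRing R] [AddCommGroup G] [Module R G]
    [AddCommGroup I] [Module R I] [AddCommGroup D] [Module R D] (hD : Module.Baer R D)
    (q : I →ₗ[R] D) (hlift : ∀ φ : G →ₗ[R] D, ∃ f : G →ₗ[R] I, q ∘ₗ f = φ)
    (F : Ordinal.{0} → Submodule R G) (hF : ∀ ⦃α β⦄, α ≤ β → β < ω₁ → F α ≤ F β)
    (hχ : ∀ α, 0 < α → α < ω₁ → ∃ χ : G →ₗ[R] D, (∀ x ∈ F α, χ x = 0) ∧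
      ∀ h : G →ₗ[R] I, (∀ x ∈ F α, h x = 0) → ¬ ∀ x ∈ F (Order.succ α), q (h x) = χ x) :
    ∃ p : Ordinal.{0} → (G → I) → Bool,
      (∀ α f g, Set.EqOn f g (F α) → p α f = p α g) ∧
      ∀ ε : Ordinal.{0} → Bool, ∃ f : G → I, ∀ α, 0 < α → α < ω₁ → p α f = ε α := by
  classical
  have hω : Order.IsSuccLimit (ω₁ : Ordinal.{0}) := Cardinal.isSuccLimit_omega 1
  have hχ' : ∀ α, ∃ χ : G →ₗ[R] D, (∀ x ∈ F α, χ x = 0) ∧ (0 < α → α < ω₁ →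
      ∀ h : G →ₗ[R] I, (∀ x ∈ F α, h x = 0) → ¬ ∀ x ∈ F (Order.succ α), q (h x) = χ x) := by
    intro α
    by_cases h : 0 < α ∧ α < ω₁
    · obtain ⟨χ, h1, h2⟩ := hχ α h.1 h.2
      exact ⟨χ, h1, fun _ _ => h2⟩
    · exact ⟨0, fun _ _ => rfl, fun h1 h2 => absurd ⟨h1, h2⟩ h⟩
  choose χ hχ0 hχ1 using hχ'
  choose E hE using fun α => hD.exists_extend (F α)
  have hEres : ∀ α (ψ : G →ₗ[R] D), ∀ x ∈ F α, E α (ψ.domRestrict (F α)) x = ψ x :=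
    fun α ψ x hx => hE α (ψ.domRestrict (F α)) ⟨x, hx⟩
  have hEcongr : ∀ α (ψ ψ' : G →ₗ[R] D), (∀ x ∈ F α, ψ x = ψ' x) →
      E α (ψ.domRestrict (F α)) = E α (ψ'.domRestrict (F α)) := by
    intro α ψ ψ' h
    congr 1
    ext x
    exact h x x.2
  -- The bit asks whether `f` on `F α` is compatible with a lift of the extension shifted by `χ α`.
  -- If the unshifted extension lifts too, the difference of the lifts would lift `χ α`.
  refine ⟨fun α f => decide (∃ h : G →ₗ[R] I, Set.EqOn h f (F α) ∧ ∀ x ∈ F (Order.succ α),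
    q (h x) = E α ((q ∘ₗ h).domRestrict (F α)) x + χ α x), fun α f g hfg => ?_, fun ε => ?_⟩
  · have : ∀ h : G →ₗ[R] I, Set.EqOn h f (F α) ↔ Set.EqOn h g (F α) :=
      fun h => ⟨fun h1 => h1.trans hfg, fun h1 => h1.trans hfg.symm⟩
    simp only [this]
  · obtain ⟨φ, hφ⟩ := hD.exists_fixed_of_steps (ι := Set.Iio (ω₁ : Ordinal.{0}))
      (fun α => F α) (fun α => F (Order.succ α))
      (fun α => hF (Order.le_succ _) (hω.succ_lt α.2))
      (fun α β h => hF (Order.succ_le_of_lt h) β.2)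
      (fun α ψ => E α (ψ.domRestrict (F α)) + if ε α then χ α else 0)
      (fun α ψ x hx => by
        rw [LinearMap.add_apply, hEres α ψ x hx]
        split_ifs <;> simp [hχ0 α x hx])
      (fun α ψ ψ' h x _ => by rw [hEcongr α ψ ψ' h])
    obtain ⟨f, rfl⟩ := hlift φ
    refine ⟨f, fun α h0 hα => ?_⟩
    have hfα := hφ ⟨α, hα⟩
    cases hε : ε α
    · rw [decide_eq_false_iff_not]
      rintro ⟨h, hhf, hh⟩
      refine hχ1 α h0 hα (h - f) (fun x hx => by simpa [sub_eq_zero] using hhf hx) fun x hx => ?_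
      have h1 := hfα x hx
      simp only [hε, LinearMap.comp_apply, LinearMap.add_apply] at h1
      have h2 := hEcongr α (q ∘ₗ h) (q ∘ₗ f) fun y hy => congr_arg q (hhf hy)
      rw [LinearMap.sub_apply, map_sub, hh x hx, h2, h1]
      simp
    · rw [decide_eq_true_eq]
      refine ⟨f, fun x _ => rfl, fun x hx => ?_⟩
      have h1 := hfα x hx
      simpa [hε] using h1

end Bits

/-! ### Size and splitting in filtered modules -/

section Cardinality

theorem nonempty_prod_embedding {X Y : Type*} (hX : Nonempty (X ↪ (ℕ → Bool)))
    (hY : Nonempty (Y ↪ (ℕ → Bool))) : Nonempty (X × Y ↪ (ℕ → Bool)) := by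
  obtain ⟨i⟩ := hX
  obtain ⟨j⟩ := hY
  obtain ⟨k⟩ := nonempty_countable_pi_embedding (S := Bool) ⟨Function.Embedding.refl (ℕ → Bool)⟩
  refine ⟨⟨fun p => k fun b => cond b (i p.1) (j p.2), fun p p' h => ?_⟩⟩
  have h' := k.injective h
  exact Prod.ext (i.injective (congr_fun h' true)) (j.injective (congr_fun h' false))

theorem nonempty_embedding_of_countable {X : Type*} [Countable X] :
    Nonempty (X ↪ (ℕ → Bool)) := by
  obtain ⟨e, he⟩ := exists_injective_nat X
  refine ⟨⟨fun x n => decide (e x = n), fun x y h => he ?_⟩⟩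
  have := congr_fun h (e y)
  simpa using this

theorem nonempty_embedding_Iio_omega_one :
    Nonempty (Set.Iio (ω₁ : Ordinal.{0}) ↪ (ℕ → Bool)) := by
  refine Cardinal.lift_mk_le'.1 ?_
  rw [Cardinal.mk_Iio_ordinal, Ordinal.card_omega]
  simpa using Cardinal.aleph_one_le_continuum

variable {R : Type*} [CommRing R] {G : Type*} [AddCommGroup G] [Module R G]

theorem IsAlephOneFiltration.nonempty_embedding {F : Ordinal.{0} → Submodule R G}
    (hF : IsAlephOneFiltration F) : Nonempty (G ↪ (ℕ → Bool)) := by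
  choose a ha hxa using hF.union
  have : ∀ α : Set.Iio (ω₁ : Ordinal.{0}), ∃ e : F α → ℕ, Function.Injective e := fun α =>
    have := hF.countable α α.2
    exists_injective_nat _
  choose e he using this
  obtain ⟨i⟩ := nonempty_prod_embedding nonempty_embedding_Iio_omega_one
    (nonempty_embedding_of_countable (X := ℕ))
  refine ⟨⟨fun x => i (⟨a x, ha x⟩, e ⟨a x, ha x⟩ ⟨x, hxa x⟩), fun x y h => ?_⟩⟩
  have h' := i.injective h
  have key : ∀ (α β : Set.Iio (ω₁ : Ordinal.{0})) (u : F α) (w : F β), α = β →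
      e α u = e β w → (u : G) = w := by
    rintro α _ u w rfl h
    exact congr_arg _ (he α h)
  exact key _ _ ⟨x, hxa x⟩ ⟨y, hxa y⟩ (Prod.ext_iff.1 h').1 (Prod.ext_iff.1 h').2

theorem IsAlephOneFiltration.isTorsionFree [IsDomain R] {F : Ordinal.{0} → Submodule R G}
    (hF : IsAlephOneFiltration F) : Module.IsTorsionFree R G := by
  refine Module.IsTorsionFree.of_smul_eq_zero fun r x h => ?_
  obtain ⟨α, hα, hx⟩ := hF.union x
  have := hF.free α hα
  have h0 : r • (⟨x, hx⟩ : F α) = 0 := Subtype.ext h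
  rcases smul_eq_zero.1 h0 with h | h
  · exact Or.inl h
  · exact Or.inr (congr_arg Subtype.val h)

/-- Some element of `G` can be completed to a basis at all late stages of the filtration, so that
it can be split off together with any countable set. -/
theorem IsAlephOneFiltration.exists_functional [IsDomain R] [IsPrincipalIdealRing R]
    {F : Ordinal.{0} → Submodule R G} (hF : IsAlephOneFiltration F) {α : Ordinal.{0}}
    (hα : α < ω₁) (hne : Nontrivial (F α)) :
    ∃ x : G, ∀ (C : Type v) [Countable C] (g : C → G), ∃ N : Submodule R G, ∃ hx : x ∈ N,
      (∀ c, g c ∈ N) ∧ ∃ π : N →ₗ[R] R, π ⟨x, hx⟩ = 1 := by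
  have := hF.free α hα
  let b := Module.Free.chooseBasis R (F α)
  obtain ⟨i⟩ := b.index_nonempty
  refine ⟨b i, fun C _ g => ?_⟩
  choose a ha hga using fun c => hF.union (g c)
  let β : Ordinal.{0} := max α (⨆ c, a c)
  have hβ : β < ω₁ := max_lt hα (Ordinal.iSup_lt_omega_one ha)
  have hx : (b i : G) ∈ F β := hF.mono (le_max_left _ _) hβ (b i).2
  have hle : ∀ c, a c ≤ β := fun c =>
    (le_ciSup Ordinal.bddAbove_of_small c).trans (le_max_right _ _)
  refine ⟨F β, hx, fun c => hF.mono (hle c) hβ (hga c), ?_⟩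
  have := hF.free β hβ
  let b' := Module.Free.chooseBasis R (F β)
  let x : F β := ⟨b i, hx⟩
  -- The generator `d` of the ideal of values at `x` divides all coordinates of `x`. By purity `x`
  -- is then divisible by `d` already in `F α`, where it is a basis element, so `d` is a unit.
  let J : Ideal R := LinearMap.range (LinearMap.applyₗ (R := R) (M₂ := R) x)
  obtain ⟨d, hd⟩ := (IsPrincipalIdealRing.principal J).principal
  obtain ⟨π, hπ⟩ : d ∈ J := hd ▸ Submodule.mem_span_singleton_self d
  have hdvd : ∀ k, ∃ y, d * y = b'.repr x k := by
    intro k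
    have h1 : b'.repr x k ∈ J := ⟨b'.coord k, rfl⟩
    rw [hd] at h1
    obtain ⟨y, hy⟩ := Ideal.mem_span_singleton.1 h1
    exact ⟨y, hy.symm⟩
  choose y hy using hdvd
  have hxy : x = d • ∑ k ∈ (b'.repr x).support, y k • b' k := by
    rw [Finset.smul_sum]
    conv_lhs => rw [← b'.linearCombination_repr x]
    rw [Finsupp.linearCombination_apply, Finsupp.sum]
    exact Finset.sum_congr rfl fun k _ => by rw [smul_smul, hy]
  set z := ∑ k ∈ (b'.repr x).support, y k • b' k
  have hxz : (b i : G) = d • (z : G) := congr_arg Subtype.val hxy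
  obtain ⟨w, hw, hdw⟩ := hF.pure α hα d z (hxz ▸ (b i).2)
  have h1 : b i = d • (⟨w, hw⟩ : F α) := Subtype.ext (hxz.trans hdw.symm)
  have h2 : 1 = d * b.repr ⟨w, hw⟩ i := by
    have := congr_arg (b.coord i) h1
    rwa [map_smul, b.coord_apply, b.coord_apply, b.repr_self, Finsupp.single_eq_same,
      smul_eq_mul] at this
  have h3 : π x = d := hπ
  exact ⟨b.repr ⟨w, hw⟩ i • π, by
    rw [LinearMap.smul_apply, h3, smul_eq_mul, mul_comm, ← h2]⟩

end Cardinality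

/-! ### Subrings of `ℚ` -/

section RationalSubring

variable (R : Subring ℚ)

theorem Subring.inv_den_mem {x : ℚ} (hx : x ∈ R) : (x.den : ℚ)⁻¹ ∈ R := by
  have hcop : IsCoprime x.num (x.den : ℤ) := Int.isCoprime_iff_nat_coprime.2 (by
    simpa using x.reduced)
  obtain ⟨u, w, h⟩ := hcop
  have h' : (u : ℚ) * x.num + w * x.den = 1 := by exact_mod_cast h
  have hnum : (x.num : ℚ) = x * x.den := (Rat.mul_den_eq_num x).symm
  have : (x.den : ℚ)⁻¹ = u * x + w := by
    exact (eq_inv_of_mul_eq_one_left (by rw [← h', hnum]; ring)).symm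
  rw [this]
  exact add_mem (mul_mem (intCast_mem R u) hx) (intCast_mem R w)

/-- Denominators of elements of `R` are units in `R`, so an ideal is generated by the integers it
contains. -/
instance Subring.isPrincipalIdealRing_rat : IsPrincipalIdealRing R := by
  refine ⟨fun J => ?_⟩
  obtain ⟨n, hn⟩ := (IsPrincipalIdealRing.principal (J.comap (Int.castRingHom R))).principal
  have hnJ : (n : R) ∈ J := by
    have : n ∈ J.comap (Int.castRingHom R) := hn ▸ Submodule.mem_span_singleton_self n
    simpa using this
  refine ⟨(n : R), le_antisymm (fun x hx => ?_) ?_⟩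
  · have hden : ((x : ℚ).den : ℚ) ≠ 0 := by exact_mod_cast (x : ℚ).den_nz
    have h1 : (x : ℚ).num ∈ J.comap (Int.castRingHom R) := by
      rw [Ideal.mem_comap]
      have : Int.castRingHom R (x : ℚ).num = ((x : ℚ).den : R) * x := by
        apply Subtype.ext
        have := Rat.mul_den_eq_num (x : ℚ)
        simp only [eq_intCast, Subring.coe_intCast, Subring.coe_mul, Subring.coe_natCast]
        rw [← this, mul_comm]
      rw [this]
      exact J.mul_mem_left _ hx
    rw [hn] at h1
    obtain ⟨m, hm⟩ := Ideal.mem_span_singleton.1 h1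
    refine Ideal.mem_span_singleton.2 ⟨(m : R) * ⟨_, R.inv_den_mem x.2⟩, Subtype.ext ?_⟩
    have := Rat.mul_den_eq_num (x : ℚ)
    simp only [Subring.coe_intCast, Subring.coe_mul]
    rw [← mul_assoc, eq_mul_inv_iff_mul_eq₀ hden, this, hm]
    push_cast
    rfl
  · exact (Ideal.span_singleton_le_iff_mem J).2 hnJ

instance Subring.isFractionRing_rat : IsFractionRing R ℚ :=
  IsFractionRing.of_field R ℚ fun z => ⟨(z.num : R), (z.den : R), by
    simpa using (Rat.num_div_den z).symm⟩

end RationalSubring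

/-! ### Lifting from vanishing `Ext¹` -/

section Lifting

open CategoryTheory

/-- If `Ext¹(M, G) = 0`, then homomorphisms on `M` lift along surjections with kernel `G`. -/
theorem exists_lift_of_subsingleton_ext {R : Type} [CommRing R] {M G I D : Type v}
    [AddCommGroup M] [Module R M] [AddCommGroup G] [Module R G] [AddCommGroup I] [Module R I]
    [AddCommGroup D] [Module R D]
    (hext : Subsingleton (Abelian.Ext.{v} (ModuleCat.of.{v} R M) (ModuleCat.of.{v} R G) 1))
    (i : G →ₗ[R] I) (q : I →ₗ[R] D) (hi : Function.Injective i) (hq : Function.Surjective q)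
    (hiq : Function.Exact i q) (φ : M →ₗ[R] D) : ∃ f : M →ₗ[R] I, q ∘ₗ f = φ := by
  let S : ShortComplex (ModuleCat.{v} R) :=
    ModuleCat.shortComplexOfCompEqZero i q hiq.linearMap_comp_eq_zero
  have hS : S.ShortExact := ModuleCat.shortComplex_shortExact S hiq hi hq
  obtain ⟨x, hx⟩ := Abelian.Ext.covariant_sequence_exact₃ (X := ModuleCat.of.{v} R M) hS
    (Abelian.Ext.mk₀ (ModuleCat.ofHom φ)) (zero_add 1) (hext.elim _ _)
  obtain ⟨f, rfl⟩ := (Abelian.Ext.mk₀_bijective _ _).2 x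
  rw [Abelian.Ext.mk₀_comp_mk₀] at hx
  have h := (Abelian.Ext.mk₀_bijective _ _).1 hx
  exact ⟨f.hom, congr_arg ModuleCat.Hom.hom h⟩

end Lifting

/-! ### Homomorphisms without a lift -/

section NonLifting

variable {R : Type*} [CommRing R] [IsDomain R]

theorem exists_finite_rank_span {C : Type*} [AddCommGroup C] [Module R C]
    (h : Module.rank R C < ℵ₀) :
    ∃ s : Set C, s.Finite ∧ ∀ c : C, ∃ r : R, r ≠ 0 ∧ r • c ∈ Submodule.span R s := by
  obtain ⟨s, hs, hmax⟩ := exists_maximal_linearIndepOn R (id : C → C)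
  rw [Set.image_id] at hmax
  refine ⟨s, Cardinal.lt_aleph0_iff_set_finite.1 (hs.cardinal_le_rank.trans_lt h), fun c => ?_⟩
  by_cases hc : c ∈ s
  · exact ⟨1, one_ne_zero, by simpa using Submodule.subset_span hc⟩
  · exact hmax c hc

variable [IsPrincipalIdealRing R] (K : Type*) [Field K] [Algebra R K] [IsFractionRing R K]

/-- A module of finite rank which is not finitely generated has a homomorphism into `I / G` which
does not lift to `I`, where `I` is an injective module containing `G` and some element of `G`
can be split off together with any countable subset. -/
theorem exists_hom_not_lift [Countable K] {C G I : Type*} [Countable C] [AddCommGroup C]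
    [Module R C] [AddCommGroup G] [Module R G] [AddCommGroup I] [Module R I]
    (hI : Module.Baer R I) (i : G →ₗ[R] I) (hi : Function.Injective i)
    (hrank : Module.rank R C < ℵ₀) (hfin : ¬ Module.Finite R C) (x : G)
    (hx : ∀ g : C → G, ∃ N : Submodule R G, ∃ hx : x ∈ N,
      (∀ c, g c ∈ N) ∧ ∃ π : N →ₗ[R] R, π ⟨x, hx⟩ = 1) :
    ∃ χ : C →ₗ[R] I ⧸ LinearMap.range i, ∀ f : C →ₗ[R] I,
      (LinearMap.range i).mkQ ∘ₗ f ≠ χ := by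
  obtain ⟨s, hs, hsC⟩ := exists_finite_rank_span hrank
  obtain ⟨χ, hχ⟩ := exists_hom_fieldModRing_not_lift R K s hs hsC hfin
  obtain ⟨j, hj⟩ := hI.extension_property (Algebra.linearMap R K) (IsFractionRing.injective R K)
    (LinearMap.toSpanSingleton R I (i x))
  have hj' : ∀ r : R, j (algebraMap R K r) = i (r • x) := fun r => by
    rw [map_smul]
    exact LinearMap.congr_fun hj r
  let jq : FieldModRing R K →ₗ[R] I ⧸ LinearMap.range i := Submodule.mapQ _ _ j (by
    rintro _ ⟨r, rfl⟩
    exact ⟨r • x, (hj' r).symm⟩)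
  refine ⟨jq ∘ₗ χ, fun f hf => ?_⟩
  have hc : ∀ c, ∃ (k : K) (g : G),
      (LinearMap.range (Algebra.linearMap R K)).mkQ k = χ c ∧ f c = j k + i g := by
    intro c
    obtain ⟨k, hk⟩ := Submodule.mkQ_surjective _ (χ c)
    have h1 : (LinearMap.range i).mkQ (f c) = (LinearMap.range i).mkQ (j k) := by
      have := LinearMap.congr_fun hf c
      simp only [LinearMap.comp_apply, ← hk] at this
      exact this
    obtain ⟨g, hg⟩ := (Submodule.Quotient.eq _).1 h1
    exact ⟨k, g, hk, by rw [hg]; abel⟩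
  choose k g hk hfc using hc
  obtain ⟨N, hxN, hgN, π, hπ⟩ := hx g
  -- `p` retracts `j` and sends `i N` into `R`. As `f c = j k + i g` with `g ∈ N`, the map `p ∘ₗ f`
  -- would lift `χ` to `K`.
  obtain ⟨p, hp⟩ := (baer_fractionRing R K).extension_property (i ∘ₗ N.subtype)
    (hi.comp N.injective_subtype) (Algebra.linearMap R K ∘ₗ π)
  have hp' : ∀ y : N, p (i y) = algebraMap R K (π y) := fun y => LinearMap.congr_fun hp y
  have hpj : ∀ y : K, p (j y) = y := by
    intro y
    obtain ⟨a, b, hb, rfl⟩ := IsFractionRing.div_surjective (A := R) y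
    have hbK : algebraMap R K b ≠ 0 := by simpa using nonZeroDivisors.ne_zero hb
    apply mul_left_cancel₀ hbK
    rw [← Algebra.smul_def, ← map_smul, ← map_smul, Algebra.smul_def, mul_div_cancel₀ _ hbK, hj',
      map_smul, map_smul, hp' ⟨x, hxN⟩, hπ, map_one, Algebra.smul_def, mul_one]
  refine hχ (p ∘ₗ f) (LinearMap.ext fun c => ?_)
  rw [LinearMap.comp_apply, LinearMap.comp_apply, hfc, map_add, map_add, hpj, hk,
    hp' ⟨g c, hgN c⟩]
  exact add_eq_left.2 ((Submodule.Quotient.mk_eq_zero _).2 ⟨_, rfl⟩)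

end NonLifting

/-! ### The main theorem -/

theorem proposition5p1 (hCH : (𝔠 : Cardinal.{0}) = ℵ₁)
    (R : Subring ℚ) (G : Type v) [AddCommGroup G] [Module R G] (hG : IsTypeI R G) :
    ¬ IsSplitter R G := by
  intro hsplit
  obtain ⟨F, hF, hmin⟩ := hG
  have hω : Order.IsSuccLimit (ω₁ : Ordinal.{0}) := Cardinal.isSuccLimit_omega 1
  have htf : Module.IsTorsionFree R G := hF.isTorsionFree
  let I := LocalizedModule (nonZeroDivisors R) G
  let i : G →ₗ[R] I := LocalizedModule.mkLinearMap (nonZeroDivisors R) G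
  have hi : Function.Injective i :=
    (IsLocalizedModule.injective_iff_isRegular (nonZeroDivisors R) i).2 fun c =>
      IsSMulRegular.of_ne_zero (nonZeroDivisors.ne_zero c.2)
  have hdiv : ∀ r : R, r ≠ 0 → ∀ y : I, ∃ z : I, r • z = y := fun r hr y =>
    ((Module.End.isUnit_iff _).1 (IsLocalizedModule.map_units i
      ⟨r, mem_nonZeroDivisors_of_ne_zero hr⟩)).2 y
  have hI : Module.Baer R I := .of_smul_surjective hdiv
  have hIcard : Nonempty (I ↪ (ℕ → Bool)) := by
    obtain ⟨e⟩ := nonempty_prod_embedding hF.nonempty_embedding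
      (nonempty_embedding_of_countable (X := nonZeroDivisors R))
    exact ⟨(Function.Embedding.ofSurjective _
      (IsLocalizedModule.mk'_surjective (nonZeroDivisors R) i)).trans e⟩
  have h1 : (1 : Ordinal.{0}) < ω₁ := by simpa using hω.succ_lt (Ordinal.omega_pos 1)
  -- `F 0` and `F 1` may vanish, but the quotient of `F 2` by `F 1` is not free, hence nonzero.
  have hnt : Nontrivial (F (Order.succ 1)) := by
    by_contra hsub
    rw [not_nontrivial_iff_subsingleton] at hsub
    exact (hmin 1 zero_lt_one h1).not_free (Module.Free.of_subsingleton R _)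
  obtain ⟨x, hx⟩ := hF.exists_functional (hω.succ_lt h1) hnt
  let D := I ⧸ LinearMap.range i
  let q : I →ₗ[R] D := (LinearMap.range i).mkQ
  have hD : Module.Baer R D := .quotient _ hdiv
  obtain ⟨p, hp, hpε⟩ := exists_bit_functions hD q
    (exists_lift_of_subsingleton_ext hsplit i q hi (Submodule.mkQ_surjective _)
      (LinearMap.exact_map_mkQ_range i)) F hF.mono (by
      intro α h0 hα
      have hα' := hω.succ_lt hα
      have := hF.countable _ hα'
      have hmα := hmin α h0 hα
      have := hmα.torsionFree
      let A := (F α).submoduleOf (F (Order.succ α))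
      have : Countable (↥(F (Order.succ α)) ⧸ A) := A.mkQ_surjective.countable
      obtain ⟨χ, hχ⟩ := exists_hom_not_lift ℚ hI i hi hmα.finite_rank
        (fun h => hmα.not_free Module.free_of_finite_type_torsion_free') x (hx _)
      obtain ⟨ψ, hψ⟩ := hD.exists_extend (F (Order.succ α)) (χ ∘ₗ A.mkQ)
      have hle : F α ≤ F (Order.succ α) := hF.mono (Order.le_succ α) hα'
      refine ⟨ψ, fun y hy => ?_, fun h hh hq => ?_⟩
      · refine (hψ ⟨y, hle hy⟩).trans ?_
        have : A.mkQ ⟨y, hle hy⟩ = 0 := (Submodule.Quotient.mk_eq_zero _).2 hy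
        rw [LinearMap.comp_apply, this, map_zero]
      · refine hχ (A.liftQ (h.domRestrict (F (Order.succ α))) fun y hy => hh y hy) ?_
        refine (LinearMap.cancel_right A.mkQ_surjective).1 (LinearMap.ext fun y => ?_)
        exact (hq y y.2).trans (hψ y))
  obtain ⟨ε, hε⟩ := exists_bits_ne_of_continuum_eq_aleph_one hCH hIcard (fun α => (F α : Set G))
    (fun α hα => Set.countable_coe_iff.1 (hF.countable α hα)) (fun α β h hβ => hF.mono h hβ)
    hF.continuous p hp
  obtain ⟨f, hf⟩ := hpε ε
  obtain ⟨α, h0, hα, hne⟩ := hε f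
  exact hne (hf α h0 hα)
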